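/- All rings are associative and unital, not necessarily commutative, and ring homomorphisms preserve $1$. A pair $(A,I)$ is a ring $A$ with a two-sided ideal $I$; a morphism of pairs $(A,I)\to(B,J)$ is a ring homomorphism $\varphi:A\to B$ with $\varphi^{-1}(J)=I$. A local pair is a pair $(A,I)$ in which the nonunits of $A$ form an ideal (i.e. $A$ is a local ring) and $I$ is this ideal, the maximal ideal of $A$. Put $I^{(1)}=I$ and let $I^{(n+1)}$ be the two-sided ideal of $A$ generated by all $st-ts$ with $s\in A$, $t\in I^{(n)}$; the pair $(A,I)$ is perfect if $\bigcap_{n\ge 1}I^{(n)}=0$. Polynomials are taken in an indeterminate $x$ that commutes with the coefficients, and $F\mapsto\bar F$ denotes reduction $A[x]\to(A/I)[x]$. A pair $(A,I)$ is left Henselian if $I$ is contained in the Jacobson radical of $A$ and, for every monic $F\in A[x]$ and all monic $f_1,f_2\in(A/I)[x]$ with $\bar F=f_1f_2$ and $(A/I)[x]f_1+(A/I)[x]f_2=(A/I)[x]$, there is a unique pair of monic polynomials $F_1,F_2\in A[x]$ with $F=F_1F_2$, $\bar F_1=f_1$ and $\bar F_2=f_2$. Right Henselian is defined in the same way, with $f_1(A/I)[x]+f_2(A/I)[x]=(A/I)[x]$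 as the coprimality condition. A left (resp. right) Henselization of $(A,I)$ is a perfect left (resp. right) Henselian pair $(H,K)$ together with a morphism of pairs $\eta:(A,I)\to(H,K)$ such that for every morphism of pairs $\varphi:(A,I)\to(B,J)$ to a perfect left (resp. right) Henselian pair there is a unique morphism of pairs $\psi:(H,K)\to(B,J)$ with $\varphi=\psi\circ\eta$. **Proposition.** Let $(A,I)$ be a perfect local pair. Then $(A,I)$ has a left Henselization, and every left Henselization $(H,K)$ of $(A,I)$ is a local pair. Likewise, $(A,I)$ has a right Henselization, and every right Henselization of $(A,I)$ is a local pair. -/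

import Mathlib

open Polynomial

universe u

/-! Pairs `(A, I)`: a (not necessarily commutative) unital ring `A` with a two-sided ideal `I`. -/

namespace RingPair

variable {A B : Type*} [Ring A] [Ring B]

/-- The quotient homomorphism `A → A / I`. -/
abbrev residue (I : TwoSidedIdeal A) : A →+* I.ringCon.Quotient := I.ringCon.mk'

/-- The reduction of a polynomial `F ∈ A[x]` to `(A / I)[x]`. -/
noncomputable abbrev reduction (I : TwoSidedIdeal A) (F : A[X]) : I.ringCon.Quotient[X] :=
  F.map (residue I)

/-- A ring homomorphism `φ : A → B` is a morphism of pairs `(A, I) → (B, J)` if `φ⁻¹(J) = I`. -/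
def IsHom (I : TwoSidedIdeal A) (J : TwoSidedIdeal B) (φ : A →+* B) : Prop :=
  ∀ a : A, φ a ∈ J ↔ a ∈ I

/-- `A[x] F₁ + A[x] F₂ = A[x]`. -/
def LeftCoprime (F₁ F₂ : A[X]) : Prop := ∃ G₁ G₂ : A[X], G₁ * F₁ + G₂ * F₂ = 1

/-- `F₁ A[x] + F₂ A[x] = A[x]`. -/
def RightCoprime (F₁ F₂ : A[X]) : Prop := ∃ G₁ G₂ : A[X], F₁ * G₁ + F₂ * G₂ = 1

/-- `(A, I)` is a Jacobson pair if `I` is contained in the Jacobson radical of `A`. -/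
def IsJacobson (I : TwoSidedIdeal A) : Prop := ∀ a ∈ I, a ∈ Ring.jacobson A

/-- The commutator filtration, indexed from `0`: `commFiltration I n` is `I⁽ⁿ⁺¹⁾`, where
`I⁽¹⁾ = I` and `I⁽ⁿ⁺¹⁾` is the two-sided ideal generated by all `s t - t s`, `s ∈ A`,
`t ∈ I⁽ⁿ⁾`. -/
def commFiltration (I : TwoSidedIdeal A) : ℕ → TwoSidedIdeal A
  | 0 => I
  | n + 1 => TwoSidedIdeal.span {c | ∃ s t : A, t ∈ commFiltration I n ∧ c = s * t - t * s}

/-- `(A, I)` is perfect if its commutator filtration has zero intersection. -/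
def IsPerfect (I : TwoSidedIdeal A) : Prop := ⨅ n, commFiltration I n = ⊥

/-- Left Henselian pairs: Jacobson pairs in which every factorization `F̄ = f₁ f₂` of the reduction
of a monic `F` into left coprime monic polynomials lifts uniquely to a factorization `F = F₁ F₂`
into monic polynomials. -/
def IsLeftHenselian (I : TwoSidedIdeal A) : Prop :=
  IsJacobson I ∧
    ∀ F : A[X], F.Monic → ∀ f₁ f₂ : I.ringCon.Quotient[X], f₁.Monic → f₂.Monic →
      LeftCoprime f₁ f₂ → reduction I F = f₁ * f₂ →
        ∃! P : A[X] × A[X], P.1.Monic ∧ P.2.Monic ∧ F = P.1 * P.2 ∧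
          reduction I P.1 = f₁ ∧ reduction I P.2 = f₂

/-- Right Henselian pairs: the same with right coprime polynomials. -/
def IsRightHenselian (I : TwoSidedIdeal A) : Prop :=
  IsJacobson I ∧
    ∀ F : A[X], F.Monic → ∀ f₁ f₂ : I.ringCon.Quotient[X], f₁.Monic → f₂.Monic →
      RightCoprime f₁ f₂ → reduction I F = f₁ * f₂ →
        ∃! P : A[X] × A[X], P.1.Monic ∧ P.2.Monic ∧ F = P.1 * P.2 ∧
          reduction I P.1 = f₁ ∧ reduction I P.2 = f₂

/-- `η : (A, I) → (H, K)` is a left Henselization: a morphism to a perfect left Henselian pair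
through which every morphism to a perfect left Henselian pair factors uniquely. -/
structure IsLeftHenselization {A H : Type u} [Ring A] [Ring H] (I : TwoSidedIdeal A)
    (K : TwoSidedIdeal H) (η : A →+* H) : Prop where
  isHom : IsHom I K η
  isPerfect : IsPerfect K
  isLeftHenselian : IsLeftHenselian K
  universal : ∀ (B : Type u) [Ring B] (J : TwoSidedIdeal B), IsPerfect J → IsLeftHenselian J →
    ∀ φ : A →+* B, IsHom I J φ → ∃! ψ : H →+* B, IsHom K J ψ ∧ ψ.comp η = φ

/-- `η : (A, I) → (H, K)` is a right Henselization: a morphism to a perfect right Henselian pair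
through which every morphism to a perfect right Henselian pair factors uniquely. -/
structure IsRightHenselization {A H : Type u} [Ring A] [Ring H] (I : TwoSidedIdeal A)
    (K : TwoSidedIdeal H) (η : A →+* H) : Prop where
  isHom : IsHom I K η
  isPerfect : IsPerfect K
  isRightHenselian : IsRightHenselian K
  universal : ∀ (B : Type u) [Ring B] (J : TwoSidedIdeal B), IsPerfect J → IsRightHenselian J →
    ∀ φ : A →+* B, IsHom I J φ → ∃! ψ : H →+* B, IsHom K J ψ ∧ ψ.comp η = φ

/-- `(A, I)` is a local pair: the nonunits of `A` form an ideal (that is, `A` is a local ring),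
and `I` is this ideal, which is then the unique maximal ideal of `A`. -/
def IsLocalPair (I : TwoSidedIdeal A) : Prop := (I : Set A) = nonunits A

/-- The ring of a local pair is local in the sense of Mathlib. -/
theorem IsLocalPair.isLocalRing {I : TwoSidedIdeal A} (h : IsLocalPair I) : IsLocalRing A := by
  have hm : ∀ a : A, a ∈ I ↔ ¬ IsUnit a := fun a => by
    rw [← SetLike.mem_coe, h]; rfl
  have h1 : (1 : A) ∉ I := fun h' => (hm 1).1 h' isUnit_one
  have : Nontrivial A := ⟨⟨1, 0, fun h' => h1 (h' ▸ I.zero_mem)⟩⟩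
  refine ⟨fun {a b} hab => ?_⟩
  by_contra hc
  rw [not_or] at hc
  exact h1 (hab ▸ I.add_mem ((hm a).2 hc.1) ((hm b).2 hc.2))

end RingPair

/-! The Henselization is the part of the product of all perfect Henselian pairs under `(A, I)` that
Henselian lifting forces to exist. Formal terms name its elements: they are built from `A` by ring
operations, inverses of `1 + t`, and coefficients of lifted factors. A lifting is unique, so
morphisms of Henselian pairs under `A` preserve the values of terms (`Term.map_eval`).

The residue of a value is the image of an element of `A` chosen independently of the pair
(`Term.residue_eval`). Hence whether a term lies in the ideal, or a polynomial may be factored, is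
decided over `A` alone. The simultaneous values therefore form a ring `H` with an ideal `K` such
that `H / K ≅ A / I`, and `(H, K)` is Henselian because inverses and lifted factors are again values
of terms. Projections give the universal morphisms. They are unique since each element of `H` is the
value in `H` of a term. Perfectness passes from the factors to `H`.

If `A` is local, an element of `H` outside `K` is congruent modulo `K` to a unit coming from `A`,
hence is a unit as `K` lies in the radical. The two sides differ only in the coprimality condition,
of which only preservation by ring homomorphisms is used. -/

namespace RingPair

/-! ### Pairs, their morphisms and residue rings -/

section Generalities

variable {A B C : Type*} [Ring A] [Ring B] [Ring C]

/-- Left coprimality for `true`, right coprimality for `false`. -/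
def SideCoprime : Bool → A[X] → A[X] → Prop
  | true => LeftCoprime
  | false => RightCoprime

theorem SideCoprime.map {s : Bool} {f g : A[X]} (h : SideCoprime s f g) (φ : A →+* B) :
    SideCoprime s (f.map φ) (g.map φ) := by
  cases s
  all_goals
    obtain ⟨u, v, huv⟩ := h
    refine ⟨u.map φ, v.map φ, ?_⟩
    rw [← Polynomial.map_mul, ← Polynomial.map_mul, ← Polynomial.map_add, huv, Polynomial.map_one]

/-- `P` is a factorization of `F` into monic polynomials which lifts `f₁` and `f₂`. -/
def IsFactorization (I : TwoSidedIdeal A) (F : A[X]) (f₁ f₂ : I.ringCon.Quotient[X])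
    (P : A[X] × A[X]) : Prop :=
  P.1.Monic ∧ P.2.Monic ∧ F = P.1 * P.2 ∧ reduction I P.1 = f₁ ∧ reduction I P.2 = f₂

/-- Left Henselian pairs for `true`, right Henselian pairs for `false`. -/
def IsHenselian (s : Bool) (I : TwoSidedIdeal A) : Prop :=
  IsJacobson I ∧
    ∀ F : A[X], F.Monic → ∀ f₁ f₂ : I.ringCon.Quotient[X], f₁.Monic → f₂.Monic →
      SideCoprime s f₁ f₂ → reduction I F = f₁ * f₂ → ∃! P, IsFactorization I F f₁ f₂ P

theorem residue_eq_residue_iff (I : TwoSidedIdeal A) {a b : A} :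
    residue I a = residue I b ↔ a - b ∈ I := by
  rw [← TwoSidedIdeal.rel_iff]
  exact I.ringCon.eq

theorem residue_eq_zero_iff (I : TwoSidedIdeal A) {a : A} : residue I a = 0 ↔ a ∈ I := by
  rw [← map_zero (residue I), residue_eq_residue_iff, sub_zero]

theorem residue_surjective (I : TwoSidedIdeal A) : Function.Surjective (residue I) :=
  I.ringCon.mk'_surjective

theorem isJacobson_iff {I : TwoSidedIdeal A} : IsJacobson I ↔ ∀ a ∈ I, IsUnit (1 + a) := by
  constructor
  · intro h
    have key : ∀ a ∈ I, ∃ z, z * (1 + a) = 1 := fun a ha => by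
      have h1 := h a ha
      rw [← Ideal.jacobson_bot, Ideal.mem_jacobson_iff] at h1
      obtain ⟨z, hz⟩ := h1 1
      rw [Ideal.mem_bot, mul_one, sub_eq_zero] at hz
      exact ⟨z, by rw [mul_add, mul_one, add_comm, hz]⟩
    intro a ha
    obtain ⟨z, hz⟩ := key a ha
    -- The left inverse `z` of `1 + a` equals `1 - z * a`, so it has a left inverse too and is a
    -- unit.
    obtain ⟨w, hw⟩ := key (-(z * a)) (I.neg_mem (I.mul_mem_left _ _ ha))
    have hz' : 1 + -(z * a) = z := by rw [← hz]; noncomm_ring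
    rw [hz'] at hw
    have hwa : w = 1 + a := left_inv_eq_right_inv hw hz
    exact ⟨⟨1 + a, z, hwa ▸ hw, hz⟩, rfl⟩
  · intro h a ha
    rw [← Ideal.jacobson_bot, Ideal.mem_jacobson_iff]
    intro y
    obtain ⟨u, hu⟩ := h (y * a) (I.mul_mem_left _ _ ha)
    refine ⟨(u⁻¹ : Aˣ), ?_⟩
    rw [Ideal.mem_bot, sub_eq_zero]
    calc (u⁻¹ : Aˣ) * y * a + (u⁻¹ : Aˣ) = (u⁻¹ : Aˣ) * (1 + y * a) := by noncomm_ring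
      _ = 1 := by rw [← hu, Units.inv_mul]

theorem IsHom.comp {I : TwoSidedIdeal A} {J : TwoSidedIdeal B} {K : TwoSidedIdeal C}
    {ψ : B →+* C} {φ : A →+* B} (hψ : IsHom J K ψ) (hφ : IsHom I J φ) : IsHom I K (ψ.comp φ) :=
  fun a => (hψ _).trans (hφ a)

/-- The homomorphism of residue rings induced by a morphism of pairs. -/
def residueMap {I : TwoSidedIdeal A} {J : TwoSidedIdeal B} {φ : A →+* B} (hφ : IsHom I J φ) :
    I.ringCon.Quotient →+* J.ringCon.Quotient :=
  I.ringCon.lift ((residue J).comp φ) fun x y h => by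
    rw [TwoSidedIdeal.rel_iff] at h
    exact (residue_eq_residue_iff J).2 (by rw [← map_sub]; exact (hφ _).2 h)

theorem residueMap_residue {I : TwoSidedIdeal A} {J : TwoSidedIdeal B} {φ : A →+* B}
    (hφ : IsHom I J φ) (a : A) : residueMap hφ (residue I a) = residue J (φ a) := rfl

theorem residueMap_injective {I : TwoSidedIdeal A} {J : TwoSidedIdeal B} {φ : A →+* B}
    (hφ : IsHom I J φ) : Function.Injective (residueMap hφ) := by
  rw [injective_iff_map_eq_zero]
  intro q hq
  obtain ⟨a, rfl⟩ := residue_surjective I q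
  rw [residueMap_residue, residue_eq_zero_iff] at hq
  exact (residue_eq_zero_iff I).2 ((hφ a).1 hq)

theorem reduction_map {I : TwoSidedIdeal A} {J : TwoSidedIdeal B} {φ : A →+* B}
    (hφ : IsHom I J φ) (F : A[X]) :
    reduction J (F.map φ) = (reduction I F).map (residueMap hφ) := by
  rw [reduction, reduction, Polynomial.map_map, Polynomial.map_map]
  rfl

theorem IsFactorization.map {I : TwoSidedIdeal A} {J : TwoSidedIdeal B} {φ : A →+* B}
    (hφ : IsHom I J φ) {F : A[X]} {f₁ f₂ : I.ringCon.Quotient[X]} {P : A[X] × A[X]}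
    (h : IsFactorization I F f₁ f₂ P) :
    IsFactorization J (F.map φ) (f₁.map (residueMap hφ)) (f₂.map (residueMap hφ))
      (P.1.map φ, P.2.map φ) := by
  obtain ⟨h1, h2, h3, h4, h5⟩ := h
  refine ⟨h1.map φ, h2.map φ, ?_, ?_, ?_⟩
  · rw [h3, Polynomial.map_mul]
  · rw [reduction_map hφ, h4]
  · rw [reduction_map hφ, h5]

theorem map_mem_commFiltration {I : TwoSidedIdeal A} {J : TwoSidedIdeal B} {φ : A →+* B}
    (hφ : ∀ a ∈ I, φ a ∈ J) (n : ℕ) {a : A} (ha : a ∈ commFiltration I n) :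
    φ a ∈ commFiltration J n := by
  induction n generalizing a with
  | zero => exact hφ a ha
  | succ n ih =>
    have hle : commFiltration I (n + 1) ≤ (commFiltration J (n + 1)).comap φ := by
      refine TwoSidedIdeal.span_le.2 ?_
      rintro _ ⟨x, y, hy, rfl⟩
      rw [SetLike.mem_coe, TwoSidedIdeal.mem_comap]
      exact TwoSidedIdeal.subset_span ⟨φ x, φ y, ih hy, by simp⟩
    exact (TwoSidedIdeal.mem_comap φ).1 (hle ha)

theorem isPerfect_bot : IsPerfect (⊥ : TwoSidedIdeal A) :=
  le_bot_iff.1 (iInf_le (commFiltration (⊥ : TwoSidedIdeal A)) 0)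

/-- The commutator filtration is functorial, so an element of every stage of it dies in each perfect
target. -/
theorem isPerfect_of_injective_family {ι : Type*} {β : ι → Type*} [∀ i, Ring (β i)]
    {I : TwoSidedIdeal A} {J : ∀ i, TwoSidedIdeal (β i)} (e : ∀ i, A →+* β i)
    (he : ∀ i, ∀ a ∈ I, e i a ∈ J i) (inj : ∀ a, (∀ i, e i a = 0) → a = 0)
    (hJ : ∀ i, IsPerfect (J i)) : IsPerfect I := by
  refine le_bot_iff.1 fun a ha => ?_
  rw [TwoSidedIdeal.mem_bot]
  refine inj a fun i => ?_
  rw [← TwoSidedIdeal.mem_bot, ← hJ i, TwoSidedIdeal.mem_iInf]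
  exact fun n => map_mem_commFiltration (he i) n ((TwoSidedIdeal.mem_iInf _).1 ha n)

theorem residue_bot_bijective : Function.Bijective (residue (⊥ : TwoSidedIdeal A)) := by
  refine ⟨fun a b h => ?_, residue_surjective _⟩
  rw [residue_eq_residue_iff, TwoSidedIdeal.mem_bot] at h
  exact sub_eq_zero.1 h

/-- Reduction modulo zero is bijective. This makes `A / I` one of the Henselian pairs under `(A,
I)`. -/
theorem isHenselian_bot (s : Bool) : IsHenselian s (⊥ : TwoSidedIdeal A) := by
  refine ⟨isJacobson_iff.2 fun a ha => ?_, ?_⟩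
  · rw [TwoSidedIdeal.mem_bot] at ha
    rw [ha, add_zero]
    exact isUnit_one
  · intro F _ f₁ f₂ h₁ h₂ _ hF
    have hinj : Function.Injective (reduction (⊥ : TwoSidedIdeal A)) :=
      Polynomial.map_injective _ residue_bot_bijective.1
    obtain ⟨F₁, rfl⟩ := Polynomial.map_surjective _ (residue_surjective (⊥ : TwoSidedIdeal A)) f₁
    obtain ⟨F₂, rfl⟩ := Polynomial.map_surjective _ (residue_surjective (⊥ : TwoSidedIdeal A)) f₂
    refine ⟨(F₁, F₂), ⟨Polynomial.monic_of_injective residue_bot_bijective.1 h₁,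
      Polynomial.monic_of_injective residue_bot_bijective.1 h₂,
      hinj (by rw [hF, reduction, Polynomial.map_mul]), rfl, rfl⟩, ?_⟩
    rintro ⟨G₁, G₂⟩ ⟨_, _, _, h4, h5⟩
    exact Prod.ext (hinj h4) (hinj h5)

theorem isHom_residue (I : TwoSidedIdeal A) : IsHom I ⊥ (residue I) := fun a => by
  rw [TwoSidedIdeal.mem_bot, residue_eq_zero_iff]

/-- The monic polynomial of degree `n` with the lower coefficients `c`. -/
noncomputable def monicPoly (n : ℕ) (c : ℕ → A) : A[X] :=
  X ^ n + ∑ i ∈ Finset.range n, Polynomial.C (c i) * X ^ i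

theorem monicPoly_monic (n : ℕ) (c : ℕ → A) : (monicPoly n c).Monic := by
  refine monic_X_pow_add ?_
  refine (degree_sum_le _ _).trans_lt ?_
  exact (Finset.sup_lt_iff (WithBot.bot_lt_coe n)).2 fun i hi =>
    (degree_C_mul_X_pow_le i (c i)).trans_lt (WithBot.coe_lt_coe.2 (Finset.mem_range.1 hi))

theorem map_monicPoly (φ : A →+* B) (n : ℕ) (c : ℕ → A) :
    (monicPoly n c).map φ = monicPoly n fun i => φ (c i) := by
  simp [monicPoly, Polynomial.map_sum]

theorem monicPoly_coeff {F : A[X]} (hF : F.Monic) : monicPoly F.natDegree F.coeff = F :=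
  hF.as_sum.symm

end Generalities

/-! ### Terms and their values in Henselian pairs -/

section Terms

universe v

/-- Expressions for the elements which every Henselian pair under a pair on `A` contains: built from
elements of `A` by ring operations, inverses of elements `1 + t` and coefficients of lifted
factorizations. -/
inductive Term (A : Type u) [Ring A] : Type u
  | of (a : A) : Term A
  | add (t t' : Term A) : Term A
  | mul (t t' : Term A) : Term A
  | neg (t : Term A) : Term A
  | inv (t : Term A) : Term A
  | factor (n : ℕ) (c : ℕ → Term A) (g₁ g₂ : A[X]) (b : Bool) (k : ℕ) : Term A

variable {A : Type u} [Ring A]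

/-- The reduction of `p` is the product of the monic coprime reductions of `g₁` and `g₂`. -/
structure IsFactorable (s : Bool) (I : TwoSidedIdeal A) (p g₁ g₂ : A[X]) : Prop where
  monic_left : (reduction I g₁).Monic
  monic_right : (reduction I g₂).Monic
  coprime : SideCoprime s (reduction I g₁) (reduction I g₂)
  eq_mul : reduction I p = reduction I g₁ * reduction I g₂

variable (s : Bool) (I : TwoSidedIdeal A)

open scoped Classical in
/-- A representative in `A` of the residue class of the value of a term. -/
noncomputable def Term.rep : Term A → A
  | of a => a
  | add t t' => t.rep + t'.rep
  | mul t t' => t.rep * t'.rep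
  | neg t => -t.rep
  -- The value is the inverse of `1 + t`, of residue `1` when `t` lies in the ideal. Outside the
  -- intended domain, here and in `factor`, both value and representative are `0`.
  | inv t => if t.rep ∈ I then 1 else 0
  | factor n c g₁ g₂ b k =>
    if IsFactorable s I (monicPoly n fun i => (c i).rep) g₁ g₂ then (cond b g₁ g₂).coeff k else 0

/-- A factorization of `F` which lifts the reductions of `g₁` and `g₂`. -/
noncomputable def chosenFactorization {B : Type v} [Ring B] (J : TwoSidedIdeal B)
    (F g₁ g₂ : B[X]) : B[X] × B[X] :=
  Classical.epsilon (IsFactorization J F (reduction J g₁) (reduction J g₂))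

open scoped Classical in
/-- The value of a term in a ring `B` over `A` with an ideal `J`. -/
noncomputable def Term.eval {B : Type v} [Ring B] (J : TwoSidedIdeal B) (φ : A →+* B) :
    Term A → B
  | of a => φ a
  | add t t' => t.eval J φ + t'.eval J φ
  | mul t t' => t.eval J φ * t'.eval J φ
  | neg t => -t.eval J φ
  | inv t => if t.rep s I ∈ I then Ring.inverse (1 + t.eval J φ) else 0
  | factor n c g₁ g₂ b k =>
    if IsFactorable s I (monicPoly n fun i => (c i).rep s I) g₁ g₂ then
      (cond b
        (chosenFactorization J (monicPoly n fun i => (c i).eval J φ) (g₁.map φ) (g₂.map φ)).1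
        (chosenFactorization J (monicPoly n fun i => (c i).eval J φ) (g₁.map φ) (g₂.map φ)).2).coeff
          k
    else 0

variable {s I} {B : Type v} [Ring B] {J : TwoSidedIdeal B} {φ : A →+* B}

theorem IsFactorable.existsUnique (hJ : IsHenselian s J) (hφ : IsHom I J φ) {n : ℕ} {c : ℕ → A}
    {c' : ℕ → B} (hc : ∀ i, residue J (c' i) = residue J (φ (c i))) {g₁ g₂ : A[X]}
    (h : IsFactorable s I (monicPoly n c) g₁ g₂) :
    ∃! P, IsFactorization J (monicPoly n c') (reduction J (g₁.map φ)) (reduction J (g₂.map φ))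
      P := by
  have hred : reduction J (monicPoly n c') = reduction J ((monicPoly n c).map φ) := by
    simp only [reduction, map_monicPoly, hc]
  simp only [reduction_map hφ]
  refine hJ.2 _ (monicPoly_monic _ _) _ _ (h.monic_left.map _) (h.monic_right.map _)
    (h.coprime.map _) ?_
  rw [hred, reduction_map hφ, h.eq_mul, Polynomial.map_mul]

theorem IsFactorable.chosenFactorization_spec (hJ : IsHenselian s J) (hφ : IsHom I J φ) {n : ℕ}
    {c : ℕ → A} {c' : ℕ → B} (hc : ∀ i, residue J (c' i) = residue J (φ (c i))) {g₁ g₂ : A[X]}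
    (h : IsFactorable s I (monicPoly n c) g₁ g₂) :
    IsFactorization J (monicPoly n c') (reduction J (g₁.map φ)) (reduction J (g₂.map φ))
      (chosenFactorization J (monicPoly n c') (g₁.map φ) (g₂.map φ)) :=
  Classical.epsilon_spec (h.existsUnique hJ hφ hc).exists

/-- Inverses of `1 + t` reduce to `1`, and lifted factors reduce to the prescribed ones, so nothing
depends on the pair. -/
theorem Term.residue_eval (hJ : IsHenselian s J) (hφ : IsHom I J φ) (t : Term A) :
    residue J (t.eval s I J φ) = residue J (φ (t.rep s I)) := by
  induction t with
  | of a => rfl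
  | add t t' h h' => simp only [eval, rep, map_add, h, h']
  | mul t t' h h' => simp only [eval, rep, map_mul, h, h']
  | neg t h => simp only [eval, rep, map_neg, h]
  | inv t h =>
    by_cases ht : t.rep s I ∈ I
    · have h0 : residue J (t.eval s I J φ) = 0 := by
        rw [h, residue_eq_zero_iff]
        exact (hφ _).2 ht
      have hu := isJacobson_iff.1 hJ.1 _ ((residue_eq_zero_iff J).1 h0)
      have h1 := congrArg (residue J) (Ring.mul_inverse_cancel _ hu)
      rw [map_mul, map_add, h0, map_one, add_zero, one_mul] at h1
      simp only [eval, rep, if_pos ht, h1, map_one]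
    · simp only [eval, rep, if_neg ht, map_zero]
  | factor n c g₁ g₂ b k h =>
    by_cases hf : IsFactorable s I (monicPoly n fun i => (c i).rep s I) g₁ g₂
    · obtain ⟨-, -, -, h₁, h₂⟩ := hf.chosenFactorization_spec hJ hφ h
      simp only [eval, rep, if_pos hf]
      cases b
      · simpa only [cond, reduction, coeff_map] using congrArg (fun p => p.coeff k) h₂
      · simpa only [cond, reduction, coeff_map] using congrArg (fun p => p.coeff k) h₁
    · simp only [eval, rep, if_neg hf, map_zero]

theorem Term.eval_mem_iff (hJ : IsHenselian s J) (hφ : IsHom I J φ) (t : Term A) :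
    t.eval s I J φ ∈ J ↔ t.rep s I ∈ I := by
  rw [← residue_eq_zero_iff, t.residue_eval hJ hφ, residue_eq_zero_iff]
  exact hφ _

theorem Term.isUnit_one_add_eval (hJ : IsHenselian s J) (hφ : IsHom I J φ) {t : Term A}
    (ht : t.rep s I ∈ I) : IsUnit (1 + t.eval s I J φ) :=
  isJacobson_iff.1 hJ.1 _ ((t.eval_mem_iff hJ hφ).2 ht)

/-- Morphisms of Henselian pairs under `(A, I)` preserve the values of terms. -/
theorem Term.map_eval (hJ : IsHenselian s J) (hφ : IsHom I J φ) {B' : Type*} [Ring B']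
    {J' : TwoSidedIdeal B'} (hJ' : IsHenselian s J') {ψ : B →+* B'} (hψ : IsHom J J' ψ)
    (t : Term A) : ψ (t.eval s I J φ) = t.eval s I J' (ψ.comp φ) := by
  have hφ' : IsHom I J' (ψ.comp φ) := hψ.comp hφ
  induction t with
  | of a => rfl
  | add t t' h h' => simp only [eval, map_add, h, h']
  | mul t t' h h' => simp only [eval, map_mul, h, h']
  | neg t h => simp only [eval, map_neg, h]
  | inv t h =>
    by_cases ht : t.rep s I ∈ I
    · simp only [eval, if_pos ht]
      have hu := t.isUnit_one_add_eval hJ hφ ht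
      have hu' := t.isUnit_one_add_eval hJ' hφ' ht
      have h1 := congrArg ψ (Ring.inverse_mul_cancel _ hu)
      rw [map_mul, map_add, map_one, h] at h1
      exact left_inv_eq_right_inv h1 (Ring.mul_inverse_cancel _ hu')
    · simp only [eval, if_neg ht, map_zero]
  | factor n c g₁ g₂ b k h =>
    by_cases hf : IsFactorable s I (monicPoly n fun i => (c i).rep s I) g₁ g₂
    · have h1 := (hf.chosenFactorization_spec hJ hφ fun i => (c i).residue_eval hJ hφ).map hψ
      rw [map_monicPoly, ← reduction_map, ← reduction_map, Polynomial.map_map,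
        Polynomial.map_map] at h1
      simp only [h] at h1
      have hc := fun i => (c i).residue_eval hJ' hφ'
      -- The image of the chosen factorization lifts the same residual factors, so uniqueness
      -- identifies it with the one chosen in the target.
      have h2 := (hf.existsUnique hJ' hφ' hc).unique h1 (hf.chosenFactorization_spec hJ' hφ' hc)
      simp only [eval, if_pos hf, ← h2]
      cases b
      · simp only [cond, coeff_map]
      · simp only [cond, coeff_map]
    · simp only [eval, if_neg hf, map_zero]

end Terms

/-! ### The ring of simultaneous values of terms -/

section Construction

variable {A : Type u} [Ring A]

/-- A perfect Henselian pair under `(A, I)`. -/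
structure HenselianExtension (s : Bool) (I : TwoSidedIdeal A) : Type (u + 1) where
  carrier : Type u
  ring : Ring carrier
  ideal : TwoSidedIdeal carrier
  hom : A →+* carrier
  isHom : IsHom I ideal hom
  isPerfect : IsPerfect ideal
  isHenselian : IsHenselian s ideal

variable {s : Bool} {I : TwoSidedIdeal A}

instance (E : HenselianExtension s I) : Ring E.carrier := E.ring

/-- The residue ring as a perfect Henselian pair under `(A, I)`. -/
def HenselianExtension.residueRing (s : Bool) (I : TwoSidedIdeal A) : HenselianExtension s I where
  carrier := I.ringCon.Quotient
  ring := inferInstance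
  ideal := ⊥
  hom := residue I
  isHom := isHom_residue I
  isPerfect := isPerfect_bot
  isHenselian := isHenselian_bot s

/-- The value of a term in a perfect Henselian pair under `(A, I)`. -/
noncomputable abbrev HenselianExtension.eval (E : HenselianExtension s I) (t : Term A) :
    E.carrier :=
  t.eval s I E.ideal E.hom

/-- The ring `H` consists of the simultaneous values of terms in all perfect Henselian pairs under
`(A, I)`. -/
structure IsTermRing {H : Type u} [Ring H] (e : ∀ E : HenselianExtension s I, H →+* E.carrier) :
    Prop where
  ext : ∀ h h' : H, (∀ E, e E h = e E h') → h = h'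
  exists_term : ∀ h : H, ∃ t, ∀ E, e E h = E.eval t
  exists_value : ∀ t, ∃ h : H, ∀ E, e E h = E.eval t

theorem exists_isTermRing (s : Bool) (I : TwoSidedIdeal A) :
    ∃ (H : Type u) (_ : Ring H) (e : ∀ E : HenselianExtension s I, H →+* E.carrier),
      IsTermRing e := by
  let f : Term A → ∀ E : HenselianExtension s I, E.carrier := fun t E => E.eval t
  let S : Subring (∀ E : HenselianExtension s I, E.carrier) :=
    { carrier := Set.range f
      zero_mem' := ⟨.of 0, funext fun E => map_zero E.hom⟩
      one_mem' := ⟨.of 1, funext fun E => map_one E.hom⟩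
      add_mem' := by
        rintro _ _ ⟨t, rfl⟩ ⟨t', rfl⟩
        exact ⟨.add t t', rfl⟩
      mul_mem' := by
        rintro _ _ ⟨t, rfl⟩ ⟨t', rfl⟩
        exact ⟨.mul t t', rfl⟩
      neg_mem' := by
        rintro _ ⟨t, rfl⟩
        exact ⟨.neg t, rfl⟩ }
  -- The product over all extensions lives in a larger universe, but `S` is the image of `Term A`,
  -- which lies in `u`.
  have : Small.{u} S := inferInstanceAs (Small.{u} (Set.range f))
  let r : Shrink.{u} S ≃+* S := Shrink.ringEquiv S
  refine ⟨Shrink.{u} S, inferInstance,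
    fun E => (Pi.evalRingHom _ E).comp (S.subtype.comp r.toRingHom), ?_, ?_, ?_⟩
  · intro h h' hh
    exact r.injective (Subtype.ext (funext hh))
  · intro h
    obtain ⟨t, ht⟩ := (r h).2
    exact ⟨t, fun E => (congrFun ht E).symm⟩
  · intro t
    refine ⟨r.symm ⟨f t, t, rfl⟩, fun E => ?_⟩
    change (r (r.symm _)).1 E = _
    rw [r.apply_symm_apply]

/-! ### Henselian property, universality and locality of the ring of terms -/

namespace IsTermRing

variable {H : Type u} [Ring H] {e : ∀ E : HenselianExtension s I, H →+* E.carrier}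

/-- The structure homomorphism from `A` to a ring of terms. -/
noncomputable def ofBase (he : IsTermRing e) : A →+* H :=
  have h : ∀ a E, e E (he.exists_value (.of a)).choose = E.hom a :=
    fun a => (he.exists_value (.of a)).choose_spec
  { toFun := fun a => (he.exists_value (.of a)).choose
    map_zero' := he.ext _ _ fun E => by rw [h, map_zero, map_zero]
    map_one' := he.ext _ _ fun E => by rw [h, map_one, map_one]
    map_add' := fun a b => he.ext _ _ fun E => by rw [map_add, h, h, h, map_add]
    map_mul' := fun a b => he.ext _ _ fun E => by rw [map_mul, h, h, h, map_mul] }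

theorem comp_ofBase (he : IsTermRing e) (E : HenselianExtension s I) :
    (e E).comp he.ofBase = E.hom :=
  RingHom.ext fun a => (he.exists_value (.of a)).choose_spec E

/-- The ideal of elements of a ring of terms whose values lie in the given ideals. -/
def ideal (e : ∀ E : HenselianExtension s I, H →+* E.carrier) : TwoSidedIdeal H :=
  ((HenselianExtension.residueRing s I).ideal).comap (e _)

/-- Membership of a value in the ideal depends only on its representative in `A`, so the ideal
defined through `A / I` alone fits every extension. -/
theorem isHom (he : IsTermRing e) (E : HenselianExtension s I) :
    IsHom (ideal e) E.ideal (e E) := fun h => by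
  obtain ⟨t, ht⟩ := he.exists_term h
  rw [ideal, TwoSidedIdeal.mem_comap, ht, ht, t.eval_mem_iff E.isHenselian E.isHom,
    t.eval_mem_iff (HenselianExtension.residueRing s I).isHenselian
      (HenselianExtension.residueRing s I).isHom]

theorem isHom_ofBase (he : IsTermRing e) : IsHom I (ideal e) he.ofBase := fun a => by
  rw [← he.isHom (.residueRing s I), ← RingHom.comp_apply, he.comp_ofBase]
  exact HenselianExtension.isHom _ a

theorem isPerfect (he : IsTermRing e) : IsPerfect (ideal e) :=
  isPerfect_of_injective_family e (fun E a ha => (he.isHom E a).2 ha)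
    (fun a ha => he.ext _ _ fun E => by rw [ha, map_zero]) fun E => E.isPerfect

theorem residue_ofBase_rep (he : IsTermRing e) {h : H} {t : Term A}
    (ht : ∀ E, e E h = E.eval t) :
    residue (ideal e) h = residue (ideal e) (he.ofBase (t.rep s I)) := by
  let E := HenselianExtension.residueRing s I
  apply residueMap_injective (he.isHom E)
  rw [residueMap_residue, residueMap_residue, ht, t.residue_eval E.isHenselian E.isHom,
    ← he.comp_ofBase, RingHom.comp_apply]

theorem residue_comp_ofBase_surjective (he : IsTermRing e) :
    Function.Surjective ((residue (ideal e)).comp he.ofBase) := fun q => by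
  obtain ⟨h, rfl⟩ := residue_surjective _ q
  obtain ⟨t, ht⟩ := he.exists_term h
  exact ⟨t.rep s I, (he.residue_ofBase_rep ht).symm⟩

theorem isJacobson (he : IsTermRing e) : IsJacobson (ideal e) := by
  refine isJacobson_iff.2 fun h hh => ?_
  obtain ⟨t, ht⟩ := he.exists_term h
  obtain ⟨h', hh'⟩ := he.exists_value t.inv
  have hrep : t.rep s I ∈ I := by
    let E := HenselianExtension.residueRing s I
    rw [← t.eval_mem_iff E.isHenselian E.isHom, ← HenselianExtension.eval, ← ht]
    exact (he.isHom E h).2 hh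
  have hu : ∀ E : HenselianExtension s I, IsUnit (1 + E.eval t) := fun E =>
    t.isUnit_one_add_eval E.isHenselian E.isHom hrep
  have hval : ∀ E, e E h' = Ring.inverse (1 + E.eval t) := fun E => by
    rw [hh', HenselianExtension.eval, Term.eval, if_pos hrep]
  refine ⟨⟨1 + h, h', he.ext _ _ fun E => ?_, he.ext _ _ fun E => ?_⟩, rfl⟩
  · rw [map_mul, map_add, map_one, ht, hval, Ring.mul_inverse_cancel _ (hu E)]
  · rw [map_mul, map_add, map_one, ht, hval, Ring.inverse_mul_cancel _ (hu E)]

theorem polynomial_ext (he : IsTermRing e) {p q : H[X]}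
    (h : ∀ E, p.map (e E) = q.map (e E)) : p = q := by
  ext k
  refine he.ext _ _ fun E => ?_
  rw [← coeff_map, h, coeff_map]

theorem isHenselian (he : IsTermRing e) (hI : (1 : A) ∉ I) : IsHenselian s (ideal e) := by
  refine ⟨he.isJacobson, fun F hF f₁ f₂ hf₁ hf₂ hf hmul => ?_⟩
  obtain ⟨g₁, hg₁⟩ := Polynomial.map_surjective _ he.residue_comp_ofBase_surjective f₁
  obtain ⟨g₂, hg₂⟩ := Polynomial.map_surjective _ he.residue_comp_ofBase_surjective f₂
  choose t ht using fun i => he.exists_term (F.coeff i)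
  have hfact : IsFactorable s I (monicPoly F.natDegree fun i => (t i).rep s I) g₁ g₂ := by
    -- The isomorphism `A / I ≅ H / K` carries the residual factorization back to `A / I`.
    let σ := RingEquiv.ofBijective (residueMap he.isHom_ofBase)
      ⟨residueMap_injective _, fun q => by
        obtain ⟨a, ha⟩ := he.residue_comp_ofBase_surjective q
        exact ⟨residue I a, ha⟩⟩
    have hσ : ∀ g : A[X], (g.map ((residue (ideal e)).comp he.ofBase)).map (σ.symm : _ →+* _) =
        reduction I g := fun g => by
      rw [reduction, Polynomial.map_map]
      congr 1
      exact RingHom.ext fun a => σ.symm_apply_apply (residue I a)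
    have hred : reduction (ideal e) F =
        (monicPoly F.natDegree fun i => (t i).rep s I).map
          ((residue (ideal e)).comp he.ofBase) := by
      conv_lhs => rw [← monicPoly_coeff hF]
      rw [reduction, map_monicPoly, map_monicPoly]
      congr 1
      exact funext fun i => he.residue_ofBase_rep (ht i)
    rw [hred] at hmul
    rw [← hg₁] at hf₁ hf hmul
    rw [← hg₂] at hf₂ hf hmul
    refine ⟨?_, ?_, ?_, ?_⟩
    · rw [← hσ]; exact hf₁.map _
    · rw [← hσ]; exact hf₂.map _
    · rw [← hσ, ← hσ]; exact hf.map _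
    · rw [← hσ, ← hσ, ← hσ, hmul, Polynomial.map_mul]
  let P : ∀ E : HenselianExtension s I, E.carrier[X] × E.carrier[X] := fun E =>
    chosenFactorization E.ideal (F.map (e E)) (g₁.map E.hom) (g₂.map E.hom)
  have hFE : ∀ E, F.map (e E) = monicPoly F.natDegree fun i => E.eval (t i) := fun E => by
    conv_lhs => rw [← monicPoly_coeff hF]
    rw [map_monicPoly]
    congr 1
    exact funext fun i => ht i E
  have hgE : ∀ E (g : A[X]), reduction E.ideal (g.map E.hom) =
      (g.map ((residue (ideal e)).comp he.ofBase)).map (residueMap (he.isHom E)) := fun E g => by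
    rw [reduction, Polynomial.map_map, Polynomial.map_map, ← he.comp_ofBase E]
    rfl
  have hc : ∀ (E : HenselianExtension s I) i, residue E.ideal (E.eval (t i)) =
      residue E.ideal (E.hom ((t i).rep s I)) := fun E i =>
    (t i).residue_eval E.isHenselian E.isHom
  have hP : ∀ E, IsFactorization E.ideal (F.map (e E)) (f₁.map (residueMap (he.isHom E)))
      (f₂.map (residueMap (he.isHom E))) (P E) := fun E => by
    have := hfact.chosenFactorization_spec E.isHenselian E.isHom (hc E)
    rwa [← hFE, hgE, hgE, hg₁, hg₂] at this
  have hPu : ∀ E Q, IsFactorization E.ideal (F.map (e E)) (f₁.map (residueMap (he.isHom E)))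
      (f₂.map (residueMap (he.isHom E))) Q → Q = P E := fun E Q hQ => by
    refine (hfact.existsUnique E.isHenselian E.isHom (hc E)).unique ?_ ?_
    all_goals rw [← hFE, hgE, hgE, hg₁, hg₂]
    exacts [hQ, hP E]
  -- Nontrivial residue rings make the degrees of the lifted factors the same in every extension, so
  -- one monic polynomial over `H` can represent them all.
  have hnt : ∀ E : HenselianExtension s I, Nontrivial E.ideal.ringCon.Quotient := fun E =>
    ⟨1, 0, fun h => hI <| (E.isHom 1).1 <| (residue_eq_zero_iff _).1 <| by
      rw [map_one, map_one, h]⟩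
  have key : ∀ (b : Bool) (f : (ideal e).ringCon.Quotient[X]), f.Monic →
      (∀ E, (cond b (P E).1 (P E).2).Monic ∧ reduction E.ideal (cond b (P E).1 (P E).2) =
        f.map (residueMap (he.isHom E))) →
      ∃ G : H[X], G.Monic ∧ reduction (ideal e) G = f ∧
        ∀ E, G.map (e E) = cond b (P E).1 (P E).2 := by
    intro b f hf hb
    -- The coefficients of the factor over `H` are themselves values of `factor` terms.
    choose h hh using fun k => he.exists_value (.factor F.natDegree t g₁ g₂ b k)
    have hG : ∀ E, (monicPoly f.natDegree h).map (e E) = cond b (P E).1 (P E).2 := fun E => by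
      have := hnt E
      have hdeg : (cond b (P E).1 (P E).2).natDegree = f.natDegree := by
        rw [← (hb E).1.natDegree_map (residue E.ideal)]
        have h2 := (hb E).2
        rw [reduction] at h2
        rw [h2]
        have : Nontrivial (ideal e).ringCon.Quotient := (residueMap (he.isHom E)).domain_nontrivial
        exact hf.natDegree_map _
      rw [← monicPoly_coeff (hb E).1, hdeg, map_monicPoly]
      congr 1
      funext k
      rw [hh, HenselianExtension.eval, Term.eval, if_pos hfact, ← hFE]
    refine ⟨_, monicPoly_monic f.natDegree h, ?_, hG⟩
    let E := HenselianExtension.residueRing s I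
    apply Polynomial.map_injective _ (residueMap_injective (he.isHom E))
    rw [← reduction_map, hG, (hb E).2]
  obtain ⟨F₁, hF₁, hr₁, hm₁⟩ := key true f₁ hf₁ fun E => ⟨(hP E).1, (hP E).2.2.2.1⟩
  obtain ⟨F₂, hF₂, hr₂, hm₂⟩ := key false f₂ hf₂ fun E => ⟨(hP E).2.1, (hP E).2.2.2.2⟩
  refine ⟨(F₁, F₂), ⟨hF₁, hF₂, he.polynomial_ext fun E => ?_, hr₁, hr₂⟩, ?_⟩
  · rw [Polynomial.map_mul, hm₁, hm₂]
    exact (hP E).2.2.1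
  · rintro ⟨G₁, G₂⟩ hG
    have h := fun E => hPu E _ (hG.map (he.isHom E))
    refine Prod.ext (he.polynomial_ext fun E => ?_) (he.polynomial_ext fun E => ?_)
    · rw [hm₁]; exact congrArg Prod.fst (h E)
    · rw [hm₂]; exact congrArg Prod.snd (h E)

/-- Each projection is a morphism of Henselian pairs, so it preserves values of terms, and the
projections separate elements. This gives uniqueness in `universal`. -/
theorem eq_eval (he : IsTermRing e) (hI : (1 : A) ∉ I) {h : H} {t : Term A}
    (ht : ∀ E, e E h = E.eval t) : h = t.eval s I (ideal e) he.ofBase :=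
  he.ext _ _ fun E => by
    rw [t.map_eval (he.isHenselian hI) he.isHom_ofBase E.isHenselian (he.isHom E),
      he.comp_ofBase, ht]

theorem universal (he : IsTermRing e) (hI : (1 : A) ∉ I) (B : Type u) [Ring B]
    (J : TwoSidedIdeal B) (hJ : IsPerfect J) (hJ' : IsHenselian s J) (φ : A →+* B)
    (hφ : IsHom I J φ) : ∃! ψ : H →+* B, IsHom (ideal e) J ψ ∧ ψ.comp he.ofBase = φ := by
  let E : HenselianExtension s I := ⟨B, inferInstance, J, φ, hφ, hJ, hJ'⟩
  refine ⟨e E, ⟨he.isHom E, he.comp_ofBase E⟩, ?_⟩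
  rintro ψ ⟨hψ, rfl⟩
  refine RingHom.ext fun h => ?_
  obtain ⟨t, ht⟩ := he.exists_term h
  conv_lhs => rw [he.eq_eval hI ht]
  rw [ht, t.map_eval (he.isHenselian hI) he.isHom_ofBase hJ' hψ]

theorem isLocalPair (he : IsTermRing e) (hloc : IsLocalPair I) : IsLocalPair (ideal e) := by
  have hI : ∀ a, a ∈ I ↔ ¬ IsUnit a := fun a => by rw [← SetLike.mem_coe, hloc]; rfl
  ext h
  rw [SetLike.mem_coe, mem_nonunits_iff]
  constructor
  · intro hh hu
    have h1 : he.ofBase 1 ∈ ideal e := by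
      rw [map_one, ← hu.val_inv_mul]
      exact (ideal e).mul_mem_left _ _ hh
    exact (hI 1).1 ((he.isHom_ofBase 1).1 h1) isUnit_one
  · intro hu
    obtain ⟨a, ha⟩ := he.residue_comp_ofBase_surjective (residue (ideal e) h)
    have hah : he.ofBase a - h ∈ ideal e := (residue_eq_residue_iff _).1 ha
    by_contra hh
    have haI : a ∉ I := fun haI => hh <| by
      have := (ideal e).sub_mem ((he.isHom_ofBase a).2 haI) hah
      rwa [sub_sub_cancel] at this
    obtain ⟨u, rfl⟩ := not_not.1 (mt (hI a).2 haI)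
    have h1 := isJacobson_iff.1 he.isJacobson _
      ((ideal e).neg_mem ((ideal e).mul_mem_left (he.ofBase (u⁻¹ : Aˣ)) _ hah))
    -- An element congruent to the unit `u` becomes `1` plus an element of the radical after
    -- multiplication by `u⁻¹`.
    have h2 : 1 + -(he.ofBase (u⁻¹ : Aˣ) * (he.ofBase u - h)) = he.ofBase (u⁻¹ : Aˣ) * h := by
      rw [mul_sub, ← map_mul, Units.inv_mul, map_one]
      abel
    rw [h2] at h1
    exact hu (((u⁻¹).isUnit.map he.ofBase).mul_left_iff.1 h1)

end IsTermRing

end Construction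

/-! ### Existence, and locality of every Henselization -/

section Henselization

variable {A : Type u} [Ring A]

/-- Left Henselizations for `true`, right Henselizations for `false`. -/
structure IsHenselization (s : Bool) {H : Type u} [Ring H] (I : TwoSidedIdeal A)
    (K : TwoSidedIdeal H) (η : A →+* H) : Prop where
  isHom : IsHom I K η
  isPerfect : IsPerfect K
  isHenselian : IsHenselian s K
  universal : ∀ (B : Type u) [Ring B] (J : TwoSidedIdeal B), IsPerfect J → IsHenselian s J →
    ∀ φ : A →+* B, IsHom I J φ → ∃! ψ : H →+* B, IsHom K J ψ ∧ ψ.comp η = φ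

theorem isHenselization_true_iff {H : Type u} [Ring H] {I : TwoSidedIdeal A}
    {K : TwoSidedIdeal H} {η : A →+* H} :
    IsHenselization true I K η ↔ IsLeftHenselization I K η :=
  ⟨fun h => ⟨h.1, h.2, h.3, h.4⟩, fun h => ⟨h.1, h.2, h.3, h.4⟩⟩

theorem isHenselization_false_iff {H : Type u} [Ring H] {I : TwoSidedIdeal A}
    {K : TwoSidedIdeal H} {η : A →+* H} :
    IsHenselization false I K η ↔ IsRightHenselization I K η :=
  ⟨fun h => ⟨h.1, h.2, h.3, h.4⟩, fun h => ⟨h.1, h.2, h.3, h.4⟩⟩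

theorem exists_isHenselization (s : Bool) {I : TwoSidedIdeal A} (hloc : IsLocalPair I) :
    ∃ (H : Type u) (_ : Ring H) (K : TwoSidedIdeal H) (η : A →+* H),
      IsHenselization s I K η ∧ IsLocalPair K := by
  have hI : (1 : A) ∉ I := fun h => by
    rw [← SetLike.mem_coe, hloc] at h
    exact h isUnit_one
  obtain ⟨H, _, e, he⟩ := exists_isTermRing s I
  exact ⟨H, _, IsTermRing.ideal e, he.ofBase, ⟨he.isHom_ofBase, he.isPerfect, he.isHenselian hI,
    he.universal hI⟩, he.isLocalPair hloc⟩

/-- The universal properties give a comparison with the local Henselization that has a left inverse,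
so it reflects units as well as the ideal. -/
theorem IsHenselization.isLocalPair {s : Bool} {I : TwoSidedIdeal A} (hloc : IsLocalPair I)
    {H : Type u} [Ring H] {K : TwoSidedIdeal H} {η : A →+* H} (h : IsHenselization s I K η) :
    IsLocalPair K := by
  obtain ⟨H', _, K', η', h', hK'⟩ := exists_isHenselization s hloc
  obtain ⟨ψ, ⟨hψ, hψη⟩, -⟩ := h.universal H' K' h'.isPerfect h'.isHenselian η' h'.isHom
  obtain ⟨χ, ⟨hχ, hχη⟩, -⟩ := h'.universal H K h.isPerfect h.isHenselian η h.isHom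
  have hid : χ.comp ψ = RingHom.id H :=
    (h.universal H K h.isPerfect h.isHenselian η h.isHom).unique
      ⟨hχ.comp hψ, by rw [RingHom.comp_assoc, hψη, hχη]⟩ ⟨fun _ => Iff.rfl, RingHom.id_comp η⟩
  have hunit : ∀ x, IsUnit (ψ x) ↔ IsUnit x := fun x =>
    ⟨fun hx => by simpa only [← RingHom.comp_apply, hid, RingHom.id_apply] using hx.map χ,
      fun hx => hx.map ψ⟩
  ext x
  rw [SetLike.mem_coe, ← hψ x, ← SetLike.mem_coe, hK', mem_nonunits_iff, mem_nonunits_iff, hunit]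

end Henselization

end RingPair

theorem mainTheorem6 {A : Type u} [Ring A] (I : TwoSidedIdeal A)
    (hperf : RingPair.IsPerfect I) (hloc : RingPair.IsLocalPair I) :
    ((∃ (H : Type u) (_ : Ring H) (K : TwoSidedIdeal H) (η : A →+* H),
        RingPair.IsLeftHenselization I K η) ∧
      ∀ (H : Type u) [Ring H] (K : TwoSidedIdeal H) (η : A →+* H),
        RingPair.IsLeftHenselization I K η → RingPair.IsLocalPair K) ∧
    ((∃ (H : Type u) (_ : Ring H) (K : TwoSidedIdeal H) (η : A →+* H),
        RingPair.IsRightHenselization I K η) ∧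
      ∀ (H : Type u) [Ring H] (K : TwoSidedIdeal H) (η : A →+* H),
        RingPair.IsRightHenselization I K η → RingPair.IsLocalPair K) := by
  refine ⟨⟨?_, fun H _ K η h =>
    (RingPair.isHenselization_true_iff.2 h).isLocalPair hloc⟩, ?_, fun H _ K η h =>
    (RingPair.isHenselization_false_iff.2 h).isLocalPair hloc⟩
  · obtain ⟨H, _, K, η, h, -⟩ := RingPair.exists_isHenselization true hloc
    exact ⟨H, _, K, η, RingPair.isHenselization_true_iff.1 h⟩
  · obtain ⟨H, _, K, η, h, -⟩ := RingPair.exists_isHenselization false hloc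
    exact ⟨H, _, K, η, RingPair.isHenselization_false_iff.1 h⟩
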